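/- Let $d\ge 1$ and equip $\mathbb{R}^d$ with the Euclidean norm $\|\cdot\|$; write $B(x,\rho)$ for the closed ball of radius $\rho$ centered at $x$, $\mathcal{L}^{(\varepsilon)}$ for the closed $\varepsilon$-neighborhood $\{x\in\mathbb{R}^d : \operatorname{dist}(x,\mathcal{L})\le\varepsilon\}$ of a set $\mathcal{L}$, and $\dim$ for Hausdorff dimension. Let $\mathbf{BA}_d$ be the set of badly approximable vectors, i.e. of those $x\in\mathbb{R}^d$ for which there is $c>0$ with $$\left\|x-\frac{p}{q}\right\|\ge \frac{c}{q^{1+1/d}}\qquad\text{for all } p\in\mathbb{Z}^d \text{ and all integers } q\ge 1 .$$ Let $\mu$ be a locally finite Borel measure on $\mathbb{R}^d$, with support $K=\operatorname{supp}\mu$, such that (i) $\mu$ is absolutely decaying: there are $C,\gamma,\rho_0>0$ such that for all $0<\rho<\rho_0$, all $x\in K$, all affine hyperplanes $\mathcal{L}\subset\mathbb{R}^d$ and all $\varepsilon>0$, $$\mu\big(B(x,\rho)\cap\mathcal{L}^{(\varepsilon)}\big)<C\left(\frac{\varepsilon}{\rho}\right)^{\gamma}\mu\big(B(x,\rho)\big);$$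 (ii) $\mu$ is Ahlfors regular: there are $\delta,c_1,c_2,\rho_0>0$ such that for all $x\in K$ and all $0<\rho<\rho_0$, $$c_1\rho^{\delta}\le\mu\big(B(x,\rho)\big)\le c_2\rho^{\delta}.$$ Then $\mathbf{BA}_d$ is strongly $C^1$ incompressible on $K$; that is, for every open set $U\subset\mathbb{R}^d$ with $U\cap K\neq\varnothing$ and every sequence $(f_i)_{i\ge1}$ of $C^1$ diffeomorphisms of $U$ onto (possibly different) open subsets of $\mathbb{R}^d$, $$\dim\left(\bigcap_{i=1}^{\infty} f_i^{-1}(\mathbf{BA}_d)\cap K\right)=\dim(U\cap K),$$ where $f_i^{-1}(\mathbf{BA}_d)=\{x\in U : f_i(x)\in\mathbf{BA}_d\}$. -/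

import Mathlib

open MeasureTheory

noncomputable section

/-- The set `BA_d` of badly approximable vectors of `ℝ^d` (Euclidean norm): there is `c > 0` with
`‖x - p / q‖ ≥ c / q ^ (1 + 1 / d)` for all `p ∈ ℤ^d` and all integers `q ≥ 1`. -/
def BA (d : ℕ) : Set (EuclideanSpace ℝ (Fin d)) :=
  {x | ∃ c : ℝ, 0 < c ∧ ∀ (p : Fin d → ℤ) (q : ℕ), 0 < q →
    c / (q : ℝ) ^ (1 + 1 / (d : ℝ)) ≤ ‖x - WithLp.toLp 2 (fun i => (p i : ℝ) / (q : ℝ))‖}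

/-- `L` is an affine hyperplane of `ℝ^d`: a nonempty affine subspace of dimension `d - 1`. -/
def IsAffineHyperplane {d : ℕ} (L : AffineSubspace ℝ (EuclideanSpace ℝ (Fin d))) : Prop :=
  (L : Set (EuclideanSpace ℝ (Fin d))).Nonempty ∧ Module.finrank ℝ L.direction + 1 = d

/-- `μ` is `(C, γ)`-absolutely decaying. Balls are closed, and `Metric.cthickening ε L` is the
closed `ε`-neighbourhood of `L`. -/
def IsAbsolutelyDecayingWith {d : ℕ} (C γ : ℝ) (μ : Measure (EuclideanSpace ℝ (Fin d))) : Prop :=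
  ∃ ρ₀ : ℝ, 0 < ρ₀ ∧ ∀ ρ : ℝ, 0 < ρ → ρ < ρ₀ → ∀ x ∈ μ.support,
    ∀ L : AffineSubspace ℝ (EuclideanSpace ℝ (Fin d)), IsAffineHyperplane L →
    ∀ ε : ℝ, 0 < ε →
      μ (Metric.closedBall x ρ ∩ Metric.cthickening ε (L : Set (EuclideanSpace ℝ (Fin d)))) <
        ENNReal.ofReal (C * (ε / ρ) ^ γ) * μ (Metric.closedBall x ρ)

/-- `μ` is absolutely decaying: `(C, γ)`-absolutely decaying for some positive `C, γ`. -/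
def IsAbsolutelyDecaying {d : ℕ} (μ : Measure (EuclideanSpace ℝ (Fin d))) : Prop :=
  ∃ C γ : ℝ, 0 < C ∧ 0 < γ ∧ IsAbsolutelyDecayingWith C γ μ

/-- `μ` is Ahlfors regular: `c₁ ρ ^ δ ≤ μ (B(x, ρ)) ≤ c₂ ρ ^ δ` for all `x ∈ supp μ` and all
`0 < ρ < ρ₀`, for some positive `δ, c₁, c₂, ρ₀`. -/
def IsAhlforsRegular {d : ℕ} (μ : Measure (EuclideanSpace ℝ (Fin d))) : Prop :=
  ∃ δ c₁ c₂ ρ₀ : ℝ, 0 < δ ∧ 0 < c₁ ∧ 0 < c₂ ∧ 0 < ρ₀ ∧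
    ∀ x ∈ μ.support, ∀ ρ : ℝ, 0 < ρ → ρ < ρ₀ →
      ENNReal.ofReal (c₁ * ρ ^ δ) ≤ μ (Metric.closedBall x ρ) ∧
        μ (Metric.closedBall x ρ) ≤ ENNReal.ofReal (c₂ * ρ ^ δ)

/-- `f` restricts to a `C¹` diffeomorphism of the open set `U` onto an open subset of `ℝ^d`:
`f` is `C¹` on `U`, `f(U)` is open, and `f` has a `C¹` inverse `g` on `f(U)`.
Values of `f` outside `U` play no role. -/
def IsC1DiffeoOn {d : ℕ} (f : EuclideanSpace ℝ (Fin d) → EuclideanSpace ℝ (Fin d))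
    (U : Set (EuclideanSpace ℝ (Fin d))) : Prop :=
  ContDiffOn ℝ 1 f U ∧ IsOpen (f '' U) ∧
    ∃ g : EuclideanSpace ℝ (Fin d) → EuclideanSpace ℝ (Fin d),
      ContDiffOn ℝ 1 g (f '' U) ∧ Set.LeftInvOn g f U

/-- `S` is strongly `C¹` incompressible on `K`. The preimage of `S` under `f i : U → ℝ^d`
is `U ∩ f i ⁻¹' S`. -/
def IsStronglyC1IncompressibleOn {d : ℕ} (S K : Set (EuclideanSpace ℝ (Fin d))) : Prop :=
  ∀ U : Set (EuclideanSpace ℝ (Fin d)), IsOpen U → (U ∩ K).Nonempty →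
    ∀ f : ℕ → EuclideanSpace ℝ (Fin d) → EuclideanSpace ℝ (Fin d),
      (∀ i, IsC1DiffeoOn (f i) U) →
        dimH ((⋂ i, (U ∩ f i ⁻¹' S)) ∩ K) = dimH (U ∩ K)

end

open scoped Nat InnerProductSpace

/-! Let `δ` be the regularity exponent. The lower mass bound gives `dim (U ∩ K) ≤ dim K ≤ δ`
(`dimH_support_le`), so it suffices to find, for each `t < δ`, a subset of the intersection of
dimension at least `t`.

By the simplex lemma, the rationals near `f x` at scale `ρ` with `q ^ (1 + 1/d) * ρ` small all lie
in one hyperplane. A `C¹` diffeomorphism is almost affine on small balls, so the points whose images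
come close to these rationals lie in one thin slab (`IsC1DiffeoOn.exists_slab`). Absolute decay
makes the slab carry at most half the mass of the ball, and regularity leaves room outside it for `β
^ (-t)` separated points of `K` (`exists_separated_points_off_slab`). Iterating gives a tree whose
limit set has dimension at least `t` (`exists_limit_set_of_tree`).

All maps are handled by one tree: level `n` avoids the slab of `f i` with `i` the 2-adic valuation
of `n + 1`. Each `f i` is thus treated along an arithmetic progression of levels, that is, at
geometrically decreasing scales, which suffices for bad approximability
(`mem_BA_of_geometric_scales`). The constant may depend on `i`. -/

/-! ### The simplex lemma. -/

/-- The rational vector `p / q`. -/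
noncomputable def ratVec {d : ℕ} (p : Fin d → ℤ) (q : ℕ) : EuclideanSpace ℝ (Fin d) :=
  WithLp.toLp 2 (fun i => (p i : ℝ) / (q : ℝ))

lemma ratVec_apply {d : ℕ} (p : Fin d → ℤ) (q : ℕ) (i : Fin d) :
    ratVec p q i = (p i : ℝ) / (q : ℝ) := rfl

/-- A family of `d + 1` rational vectors with small denominators in a small ball is affinely
dependent. -/
lemma det_homogeneous_ratVec_eq_zero {d : ℕ} {c : EuclideanSpace ℝ (Fin d)} {r Q : ℝ} (hr : 0 < r)
    (hQ : ((d + 1)! : ℝ) * Q ^ (d + 1) * r ^ d < 1)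
    (p : Fin (d + 1) → Fin d → ℤ) (q : Fin (d + 1) → ℕ) (hq : ∀ i, 0 < q i)
    (hqQ : ∀ i, (q i : ℝ) ≤ Q) (hp : ∀ i, ‖ratVec (p i) (q i) - c‖ ≤ r) :
    (Matrix.of fun i => (Fin.cons 1 (ratVec (p i) (q i)) : Fin (d + 1) → ℝ)).det = 0 := by
  set A : Matrix (Fin (d + 1)) (Fin (d + 1)) ℝ :=
    Matrix.of fun i => (Fin.cons 1 (ratVec (p i) (q i)) : Fin (d + 1) → ℝ) with hA
  -- Clearing denominators row by row gives an integer determinant; it vanishes once its absolute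
  -- value is below 1.
  set Z : Matrix (Fin (d + 1)) (Fin (d + 1)) ℤ :=
    Matrix.of fun i => (Fin.cons (q i : ℤ) (p i) : Fin (d + 1) → ℤ) with hZ
  have hq' : ∀ i, (q i : ℝ) ≠ 0 := fun i => by exact_mod_cast (hq i).ne'
  have hZA : ((Z.det : ℤ) : ℝ) = (∏ i, (q i : ℝ)) * A.det := by
    rw [← Matrix.det_mul_column]
    have : (Z.det : ℝ) = (Z.map (Int.castRingHom ℝ)).det := by
      rw [← RingHom.mapMatrix_apply, ← RingHom.map_det]; rfl
    rw [this]
    congr 1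
    ext i j
    refine Fin.cases ?_ (fun j => ?_) j
    · simp [hZ, hA]
    · simp [hZ, hA, ratVec_apply, mul_div_cancel₀ _ (hq' i)]
  -- Right multiplication by `T` turns a row `(1, y)` into `(r, y - c)`, so every entry becomes at
  -- most `r`, at the cost of a factor `r` in the determinant.
  set T : Matrix (Fin (d + 1)) (Fin (d + 1)) ℝ :=
    Matrix.of (Fin.cons (Fin.cons r (fun j => - c j))
      (fun i => Fin.cons 0 (fun j => if i = j then 1 else 0))) with hT
  have hdetT : T.det = r := by
    rw [Matrix.det_of_isUpperTriangular]
    · simp [Fin.prod_univ_succ, hT]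
    · intro i j hij
      refine Fin.cases (fun h => ?_) (fun i => ?_) i hij
      · exact absurd h (Fin.not_lt_zero _)
      · refine Fin.cases (fun _ => ?_) (fun j h => ?_) j
        · simp [hT]
        · have : i ≠ j := by rintro rfl; exact lt_irrefl _ h
          simp [hT, this]
  have hent : ∀ i j, |(A * T) i j| ≤ r := by
    intro i j
    refine Fin.cases ?_ (fun j => ?_) j
    · simp [Matrix.mul_apply, Fin.sum_univ_succ, hA, hT, abs_of_pos hr]
    · have h1 : (A * T) i j.succ = (ratVec (p i) (q i) - c) j := by
        simp [Matrix.mul_apply, Fin.sum_univ_succ, hA, hT]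
        ring
      rw [h1, ← Real.norm_eq_abs]
      exact (PiLp.norm_apply_le _ _).trans (hp i)
  have hdet : |(A * T).det| ≤ ((d + 1)! : ℝ) * r ^ (d + 1) := by
    have := Matrix.det_le (A := A * T) (abv := AbsoluteValue.abs) (x := r) hent
    simpa using this
  rw [Matrix.det_mul, hdetT, abs_mul, abs_of_pos hr, pow_succ, ← mul_assoc] at hdet
  have hAdet : |A.det| ≤ ((d + 1)! : ℝ) * r ^ d := le_of_mul_le_mul_right hdet hr
  have hprod : (∏ i, (q i : ℝ)) ≤ Q ^ (d + 1) := by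
    calc (∏ i, (q i : ℝ)) ≤ ∏ _i : Fin (d + 1), Q :=
          Finset.prod_le_prod (fun i _ => Nat.cast_nonneg _) (fun i _ => hqQ i)
      _ = Q ^ (d + 1) := by simp
  have hprod0 : 0 < (∏ i, (q i : ℝ)) := Finset.prod_pos fun i _ => by exact_mod_cast hq i
  have hlt : |((Z.det : ℤ) : ℝ)| < 1 := by
    rw [hZA, abs_mul, abs_of_pos hprod0]
    calc (∏ i, (q i : ℝ)) * |A.det| ≤ Q ^ (d + 1) * (((d + 1)! : ℝ) * r ^ d) :=
          mul_le_mul hprod hAdet (abs_nonneg _) (hprod0.le.trans hprod)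
      _ < 1 := by linarith
  have hZ0 : Z.det = 0 := by
    rw [← Int.abs_lt_one_iff]
    exact_mod_cast hlt
  rw [hZ0] at hZA
  simpa [hprod0.ne'] using hZA.symm

/-- The simplex lemma: the rational vectors with small denominators in a small ball lie in one
affine hyperplane. -/
lemma exists_hyperplane_of_ratVec_mem_closedBall {d : ℕ} (hd : 0 < d)
    (c : EuclideanSpace ℝ (Fin d)) {r Q : ℝ} (hr : 0 < r)
    (hQ : ((d + 1)! : ℝ) * Q ^ (d + 1) * r ^ d < 1) :
    ∃ (v : EuclideanSpace ℝ (Fin d)) (s : ℝ), ‖v‖ = 1 ∧ ∀ (p : Fin d → ℤ) (q : ℕ), 0 < q →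
      (q : ℝ) ≤ Q → ‖ratVec p q - c‖ ≤ r → ⟪v, ratVec p q⟫_ℝ = s := by
  set S : Set (Fin (d + 1) → ℝ) := {w | ∃ (p : Fin d → ℤ) (q : ℕ), 0 < q ∧ (q : ℝ) ≤ Q ∧
    ‖ratVec p q - c‖ ≤ r ∧ w = (Fin.cons 1 (ratVec p q) : Fin (d + 1) → ℝ)} with hS
  -- If the homogenised vectors `(1, p/q)` spanned, a basis chosen among them would have nonzero
  -- determinant.
  have hspan : Submodule.span ℝ S < ⊤ := by
    rw [lt_top_iff_ne_top]
    intro htop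
    obtain ⟨f, hf, -, hli⟩ := Submodule.exists_fun_fin_finrank_span_eq ℝ S
    have hfr : Module.finrank ℝ (Submodule.span ℝ S) = d + 1 := by
      rw [htop, finrank_top]; simp
    set g : Fin (d + 1) → (Fin (d + 1) → ℝ) := f ∘ Fin.cast hfr.symm with hg
    have hgli : LinearIndependent ℝ g := hli.comp _ (Fin.cast_injective _)
    have hgS : ∀ i, g i ∈ S := fun i => hf _
    choose p q hq hqQ hp hgp using hgS
    have h0 := det_homogeneous_ratVec_eq_zero hr hQ p q hq hqQ hp
    have : (Matrix.of fun i => (Fin.cons 1 (ratVec (p i) (q i)) : Fin (d + 1) → ℝ)) =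
        Matrix.of g := by
      ext i j; simp [hgp i]
    rw [this] at h0
    have hu : IsUnit (Matrix.of g) := Matrix.linearIndependent_rows_iff_isUnit.1 hgli
    exact ((Matrix.isUnit_iff_isUnit_det _).1 hu).ne_zero h0
  obtain ⟨ℓ, hℓ, hker⟩ := Submodule.exists_le_ker_of_lt_top _ hspan
  set v : EuclideanSpace ℝ (Fin d) := WithLp.toLp 2 fun j => ℓ (Pi.single j.succ 1) with hv
  have hℓv : ∀ (a : ℝ) (y : EuclideanSpace ℝ (Fin d)),
      ℓ (Fin.cons a y : Fin (d + 1) → ℝ) = a * ℓ (Pi.single 0 1) + ⟪v, y⟫_ℝ := by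
    intro a y
    rw [LinearMap.pi_apply_eq_sum_univ ℓ]
    have h1 : ∀ i : Fin (d + 1), (fun j => if i = j then (1 : ℝ) else 0) = Pi.single i 1 := by
      intro i; ext j; simp [Pi.single_apply, eq_comm]
    simp only [h1, Fin.sum_univ_succ, Fin.cons_zero, Fin.cons_succ, smul_eq_mul, PiLp.inner_apply]
    simp [hv]
  have hz : ∀ (p : Fin d → ℤ) (q : ℕ), 0 < q → (q : ℝ) ≤ Q → ‖ratVec p q - c‖ ≤ r →
      ℓ (Pi.single 0 1) + ⟪v, ratVec p q⟫_ℝ = 0 := by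
    intro p q h1 h2 h3
    have : (Fin.cons 1 (ratVec p q) : Fin (d + 1) → ℝ) ∈ LinearMap.ker ℓ :=
      hker (Submodule.subset_span ⟨p, q, h1, h2, h3, rfl⟩)
    rw [LinearMap.mem_ker, hℓv] at this
    simpa using this
  -- If `v = 0`, then `ℓ` is a nonzero multiple of the first coordinate, so no rational vector
  -- qualifies and any unit vector serves.
  by_cases hv0 : v = 0
  · have hℓ0 : ℓ (Pi.single 0 1) ≠ 0 := by
      intro h
      apply hℓ
      ext i
      refine Fin.cases ?_ (fun j => ?_) i
      · simpa using h
      · have : v j = 0 := by rw [hv0]; rfl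
        simpa [hv] using this
    refine ⟨EuclideanSpace.single ⟨0, hd⟩ 1, 0, by simp, fun p q h1 h2 h3 => ?_⟩
    have := hz p q h1 h2 h3
    simp [hv0] at this
    exact absurd this hℓ0
  · refine ⟨‖v‖⁻¹ • v, ‖v‖⁻¹ * (- ℓ (Pi.single 0 1)), ?_, fun p q h1 h2 h3 => ?_⟩
    · rw [norm_smul, norm_inv, norm_norm, inv_mul_cancel₀ (norm_ne_zero_iff.2 hv0)]
    · have := hz p q h1 h2 h3
      rw [real_inner_smul_left]
      congr 1
      linarith

/-! ### Pulling hyperplanes back through diffeomorphisms; scales and bad approximability. -/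

/-- Uniform estimates for a `C¹` diffeomorphism on a closed ball inside its domain. -/
lemma IsC1DiffeoOn.exists_uniform_bounds {d : ℕ}
    {f : EuclideanSpace ℝ (Fin d) → EuclideanSpace ℝ (Fin d)}
    {U : Set (EuclideanSpace ℝ (Fin d))} (hU : IsOpen U) (hf : IsC1DiffeoOn f U)
    {x₀ : EuclideanSpace ℝ (Fin d)} {r₀ : ℝ} (hB : Metric.closedBall x₀ r₀ ⊆ U) :
    ∃ M m : ℝ, 0 < M ∧ 0 < m ∧
      (∀ x ∈ Metric.closedBall x₀ r₀, ∀ y ∈ Metric.closedBall x₀ r₀,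
        ‖f y - f x‖ ≤ M * ‖y - x‖) ∧
      (∀ x ∈ Metric.closedBall x₀ r₀, ∀ v,
        m * ‖v‖ ≤ ‖ContinuousLinearMap.adjoint (fderiv ℝ f x) v‖) ∧
      ∀ ε : ℝ, 0 < ε → ∃ ρ₁ : ℝ, 0 < ρ₁ ∧ ∀ x ∈ Metric.closedBall x₀ r₀,
        ∀ y ∈ Metric.closedBall x₀ r₀, ‖y - x‖ ≤ ρ₁ →
          ‖f y - f x - fderiv ℝ f x (y - x)‖ ≤ ε * ‖y - x‖ := by
  obtain ⟨hfU, hopen, g, hg, hgf⟩ := hf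
  have hdiff : ∀ x ∈ U, DifferentiableAt ℝ f x := fun x hx =>
    (hfU.differentiableOn one_ne_zero).differentiableAt (hU.mem_nhds hx)
  have hDc : ContinuousOn (fderiv ℝ f) (Metric.closedBall x₀ r₀) :=
    (hfU.continuousOn_fderiv_of_isOpen hU le_rfl).mono hB
  have hcpt : IsCompact (Metric.closedBall x₀ r₀) := isCompact_closedBall _ _
  obtain ⟨M, hM⟩ := hcpt.exists_bound_of_continuousOn hDc
  have hgc : ContinuousOn (fun x => fderiv ℝ g (f x)) (Metric.closedBall x₀ r₀) :=
    (hg.continuousOn_fderiv_of_isOpen hopen le_rfl).comp (hfU.continuousOn.mono hB)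
      (fun x hx => Set.mem_image_of_mem f (hB hx))
  obtain ⟨M', hM'⟩ := hcpt.exists_bound_of_continuousOn hgc
  refine ⟨|M| + 1, (|M'| + 1)⁻¹, by positivity, by positivity, ?_, ?_, ?_⟩
  · intro x hx y hy
    refine Convex.norm_image_sub_le_of_norm_fderiv_le (fun z hz => hdiff z (hB hz))
      (fun z hz => ?_) (convex_closedBall x₀ r₀) hx hy
    exact (hM z hz).trans ((le_abs_self M).trans (by linarith))
  · intro x hx v
    set D := fderiv ℝ f x with hD
    set A := fderiv ℝ g (f x) with hA
    have hxU := hB hx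
    have hgd : DifferentiableAt ℝ g (f x) :=
      (hg.differentiableOn one_ne_zero).differentiableAt
        (hopen.mem_nhds (Set.mem_image_of_mem f hxU))
    have hcomp : A.comp D = ContinuousLinearMap.id ℝ _ := by
      have h1 : HasFDerivAt (g ∘ f) (A.comp D) x :=
        hgd.hasFDerivAt.comp x (hdiff x hxU).hasFDerivAt
      have h2 : HasFDerivAt (g ∘ f) (ContinuousLinearMap.id ℝ _) x :=
        (hasFDerivAt_id x).congr_of_eventuallyEq
          (Filter.eventuallyEq_of_mem (hU.mem_nhds hxU) hgf)
      exact h1.unique h2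
    -- A one-sided inverse is two-sided in finite dimension; a bound on `A` then bounds the adjoint
    -- of `D` from below.
    have hcomp' : (D : EuclideanSpace ℝ (Fin d) →ₗ[ℝ] EuclideanSpace ℝ (Fin d)) * A = 1 := by
      apply mul_eq_one_comm.1
      ext1 z
      exact congrArg (fun L => L z) hcomp
    have hDA : D (A v) = v := congrArg (fun L => L v) hcomp'
    have hle : ‖v‖ * ‖v‖ ≤ ‖ContinuousLinearMap.adjoint D v‖ * ((|M'| + 1) * ‖v‖) := by
      calc ‖v‖ * ‖v‖ = ⟪v, D (A v)⟫_ℝ := by rw [hDA, real_inner_self_eq_norm_mul_norm]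
        _ = ⟪ContinuousLinearMap.adjoint D v, A v⟫_ℝ := by
          rw [ContinuousLinearMap.adjoint_inner_left]
        _ ≤ ‖ContinuousLinearMap.adjoint D v‖ * ‖A v‖ := real_inner_le_norm _ _
        _ ≤ _ := by
          gcongr
          refine (A.le_opNorm v).trans ?_
          gcongr
          exact (hM' x hx).trans ((le_abs_self M').trans (by linarith))
    rw [inv_mul_le_iff₀ (by positivity)]
    rcases (norm_nonneg v).eq_or_lt with h | h
    · rw [← h]; positivity
    · exact le_of_mul_le_mul_right (by linarith) h
  · intro ε hε
    have huc := hcpt.uniformContinuousOn_of_continuous hDc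
    obtain ⟨ρ, hρ, H⟩ := Metric.uniformContinuousOn_iff.1 huc ε hε
    refine ⟨ρ / 2, by positivity, fun x hx y hy hxy => ?_⟩
    refine Convex.norm_image_sub_le_of_norm_fderiv_le'
      (s := Metric.closedBall x₀ r₀ ∩ Metric.closedBall x (ρ / 2))
      (fun z hz => hdiff z (hB hz.1)) (fun z hz => ?_)
      ((convex_closedBall _ _).inter (convex_closedBall _ _))
      ⟨hx, Metric.mem_closedBall_self (by positivity)⟩ ⟨hy, by simpa [dist_eq_norm] using hxy⟩
    rw [← dist_eq_norm]
    refine (H z hz.1 x hx ?_).le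
    have := Metric.mem_closedBall.1 hz.2
    linarith

/-- In a small ball, points off a thin slab have images far from rational vectors with small
denominators. -/
lemma IsC1DiffeoOn.exists_slab {d : ℕ} (hd : 0 < d)
    {f : EuclideanSpace ℝ (Fin d) → EuclideanSpace ℝ (Fin d)}
    {U : Set (EuclideanSpace ℝ (Fin d))} (hU : IsOpen U) (hf : IsC1DiffeoOn f U)
    {x₀ : EuclideanSpace ℝ (Fin d)} {r₀ : ℝ} (hB : Metric.closedBall x₀ r₀ ⊆ U)
    {β : ℝ} (hβ : 0 < β) :
    ∃ a b ρ₁ : ℝ, 0 < a ∧ 0 < b ∧ 0 < ρ₁ ∧ ∀ ρ : ℝ, 0 < ρ → ρ ≤ ρ₁ →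
      ∀ x ∈ Metric.closedBall x₀ r₀, ∃ (u : EuclideanSpace ℝ (Fin d)) (s : ℝ), ‖u‖ = 1 ∧
        ∀ y ∈ Metric.closedBall x₀ r₀, ‖y - x‖ ≤ ρ → β * ρ < |⟪u, y⟫_ℝ - s| →
          ∀ (p : Fin d → ℤ) (q : ℕ), 0 < q → (q : ℝ) ^ (1 + 1 / (d : ℝ)) * ρ < a →
            b * ρ ≤ ‖f y - ratVec p q‖ := by
  obtain ⟨M, m, hM, hm, hlip, hadj, hT⟩ := hf.exists_uniform_bounds hU hB
  obtain ⟨ρ₁, hρ₁, hT⟩ := hT (m * β / 2) (by positivity)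
  -- The linearisation error and the distance to the rational vector are each at most `b * ρ`,
  -- adding up to `m * β * ρ`. The radius `R * ρ` allows for the image of the ball plus `b * ρ`.
  set b := m * β / 2 with hb
  have hb0 : 0 < b := by positivity
  set R := M + b with hR
  have hR0 : 0 < R := by positivity
  set F : ℝ := ((d + 1)! : ℝ) with hF
  have hF1 : 1 ≤ F := Nat.one_le_cast.2 (Nat.factorial_pos (d + 1))
  set a := (2 * F * R)⁻¹ with ha
  have ha0 : 0 < a := by positivity
  have haR : a * R = (2 * F)⁻¹ := by rw [ha]; field_simp
  have hd0 : (0 : ℝ) < d := by exact_mod_cast hd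
  refine ⟨a, b, ρ₁, ha0, hb0, hρ₁, fun ρ hρ hρρ x hx => ?_⟩
  set e : ℝ := 1 + 1 / (d : ℝ) with he
  have he0 : 0 < e := by positivity
  -- `q ^ e < a / ρ` amounts to `q < Q`, and `e = (d + 1) / d` makes `Q ^ (d + 1) * (R * ρ) ^ d = (a
  -- * R) ^ d`, independent of `ρ`.
  set Q : ℝ := (a / ρ) ^ (e⁻¹) with hQdef
  have haρ : 0 < a / ρ := by positivity
  have hQpow : Q ^ (d + 1) = (a / ρ) ^ d := by
    rw [hQdef, ← Real.rpow_natCast, ← Real.rpow_mul haρ.le, ← Real.rpow_natCast]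
    congr 1
    rw [he]; push_cast; field_simp
  have hQ : F * Q ^ (d + 1) * (R * ρ) ^ d < 1 := by
    rw [hQpow, mul_assoc, ← mul_pow]
    have h1 : a / ρ * (R * ρ) = (2 * F)⁻¹ := by rw [← haR]; field_simp
    rw [h1]
    calc F * (2 * F)⁻¹ ^ d ≤ F * (2 * F)⁻¹ := by
          gcongr
          exact pow_le_of_le_one (by positivity) (inv_le_one_of_one_le₀ (by linarith)) hd.ne'
      _ = 1 / 2 := by field_simp
      _ < 1 := by norm_num
  obtain ⟨v, s, hv, hvs⟩ :=
    exists_hyperplane_of_ratVec_mem_closedBall hd (f x) (by positivity : 0 < R * ρ) hQ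
  set D := fderiv ℝ f x with hD
  set w := ContinuousLinearMap.adjoint D v with hw
  have hwm : m ≤ ‖w‖ := by simpa [hv] using hadj x hx v
  have hw0 : 0 < ‖w‖ := hm.trans_le hwm
  -- The preimage of the hyperplane under `y ↦ f x + D (y - x)`, with its normal normalised.
  refine ⟨‖w‖⁻¹ • w, ‖w‖⁻¹ * (s - ⟪v, f x⟫_ℝ + ⟪w, x⟫_ℝ), ?_, ?_⟩
  · rw [norm_smul, norm_inv, norm_norm, inv_mul_cancel₀ hw0.ne']
  intro y hy hyx hslab p q hq hqa
  by_contra! hlt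
  have hlip' := (hlip x hx y hy).trans (mul_le_mul_of_nonneg_left hyx hM.le)
  have hball : ‖ratVec p q - f x‖ ≤ R * ρ := by
    have : ratVec p q - f x = (f y - f x) - (f y - ratVec p q) := by abel
    rw [this]
    refine (norm_sub_le _ _).trans ?_
    rw [hR, add_mul]
    linarith
  have hqQ : (q : ℝ) ≤ Q := by
    have h1 : (q : ℝ) ^ e ≤ a / ρ := by rw [le_div_iff₀ hρ]; exact hqa.le
    calc (q : ℝ) = ((q : ℝ) ^ e) ^ (e⁻¹) := by
          rw [← Real.rpow_mul (Nat.cast_nonneg _), mul_inv_cancel₀ he0.ne', Real.rpow_one]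
      _ ≤ Q := Real.rpow_le_rpow (by positivity) h1 (by positivity)
  have hs := hvs p q hq hqQ hball
  have hkey : ⟪w, y⟫_ℝ - (s - ⟪v, f x⟫_ℝ + ⟪w, x⟫_ℝ) =
      ⟪v, (f y - ratVec p q) - (f y - f x - D (y - x))⟫_ℝ := by
    have : ⟪w, y⟫_ℝ - ⟪w, x⟫_ℝ = ⟪v, D (y - x)⟫_ℝ := by
      rw [← inner_sub_right, hw, ContinuousLinearMap.adjoint_inner_left]
    rw [← hs]
    simp only [inner_sub_right] at this ⊢
    linarith
  have hTy := (hT x hx y hy (hyx.trans hρρ)).trans (mul_le_mul_of_nonneg_left hyx hb0.le)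
  have habs : |⟪w, y⟫_ℝ - (s - ⟪v, f x⟫_ℝ + ⟪w, x⟫_ℝ)| ≤ ‖w‖ * (β * ρ) := by
    rw [hkey]
    refine (abs_real_inner_le_norm _ _).trans ?_
    rw [hv, one_mul]
    refine (norm_sub_le _ _).trans ?_
    calc ‖f y - ratVec p q‖ + ‖f y - f x - D (y - x)‖ ≤ b * ρ + b * ρ := add_le_add hlt.le hTy
      _ = m * (β * ρ) := by rw [hb]; ring
      _ ≤ ‖w‖ * (β * ρ) := by gcongr
  rw [real_inner_smul_left, ← mul_sub, abs_mul, abs_of_pos (inv_pos.2 hw0),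
    lt_inv_mul_iff₀ hw0] at hslab
  linarith

/-- A vector which stays away from rational vectors at scales along a geometric progression is
badly approximable. -/
lemma mem_BA_of_geometric_scales {d : ℕ} {z : EuclideanSpace ℝ (Fin d)} {a b σ τ : ℝ}
    (ha : 0 < a) (hb : 0 < b) (hσ : 0 < σ) (hτ : 0 < τ) (hτ1 : τ < 1)
    (h : ∀ (k : ℕ) (p : Fin d → ℤ) (q : ℕ), 0 < q →
      (q : ℝ) ^ (1 + 1 / (d : ℝ)) * (σ * τ ^ k) < a → b * (σ * τ ^ k) ≤ ‖z - ratVec p q‖) :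
    z ∈ BA d := by
  refine ⟨min (b * σ) (b * τ * a), by positivity, fun p q hq => ?_⟩
  change _ ≤ ‖z - ratVec p q‖
  set e : ℝ := 1 + 1 / (d : ℝ) with he
  have hq1 : 1 ≤ (q : ℝ) ^ e :=
    Real.one_le_rpow (by exact_mod_cast hq) (by positivity)
  have hq0 : 0 < (q : ℝ) ^ e := by linarith
  have hex : ∃ k : ℕ, (q : ℝ) ^ e * (σ * τ ^ k) < a := by
    obtain ⟨k, hk⟩ := exists_pow_lt_of_lt_one (show 0 < a / ((q : ℝ) ^ e * σ) by positivity) hτ1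
    refine ⟨k, ?_⟩
    rw [lt_div_iff₀ (by positivity)] at hk
    linarith
  classical
  -- Use the first admissible scale: if it is not the coarsest, the previous one fails, which bounds
  -- this one below by `τ * a / q ^ e`.
  have hk := Nat.find_spec hex
  refine le_trans ?_ (h _ p q hq hk)
  rw [div_le_iff₀ hq0]
  rcases Nat.eq_zero_or_pos (Nat.find hex) with h0 | hpos
  · rw [h0, pow_zero, mul_one]
    refine (min_le_left _ _).trans ?_
    exact le_mul_of_one_le_right (by positivity) hq1
  · obtain ⟨j, hj⟩ := Nat.exists_eq_succ_of_ne_zero hpos.ne'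
    have hj' : a ≤ (q : ℝ) ^ e * (σ * τ ^ j) := not_lt.1 (Nat.find_min hex (by omega))
    rw [hj]
    refine (min_le_right _ _).trans ?_
    calc b * τ * a ≤ b * τ * ((q : ℝ) ^ e * (σ * τ ^ j)) := by gcongr
      _ = _ := by rw [Nat.succ_eq_add_one, pow_succ]; ring

/-! ### Separated points of the support off a slab. -/

lemma exists_isAffineHyperplane_slab_subset {d : ℕ} {u : EuclideanSpace ℝ (Fin d)} (hu : ‖u‖ = 1)
    (s : ℝ) : ∃ L : AffineSubspace ℝ (EuclideanSpace ℝ (Fin d)), IsAffineHyperplane L ∧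
      ∀ ε : ℝ, {y | |⟪u, y⟫_ℝ - s| ≤ ε} ⊆
        Metric.cthickening ε (L : Set (EuclideanSpace ℝ (Fin d))) := by
  have hu0 : u ≠ 0 := by rintro rfl; simp at hu
  have huu : ⟪u, u⟫_ℝ = 1 := by rw [real_inner_self_eq_norm_sq, hu]; norm_num
  refine ⟨AffineSubspace.mk' (s • u) (ℝ ∙ u)ᗮ, ⟨⟨s • u, AffineSubspace.self_mem_mk' _ _⟩, ?_⟩, ?_⟩
  · rw [AffineSubspace.direction_mk']
    have h := Submodule.finrank_add_finrank_orthogonal (ℝ ∙ u)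
    rw [finrank_span_singleton hu0, finrank_euclideanSpace_fin] at h
    omega
  · intro ε y hy
    refine Metric.mem_cthickening_of_dist_le y (y - (⟪u, y⟫_ℝ - s) • u) ε _ ?_ ?_
    · rw [SetLike.mem_coe, AffineSubspace.mem_mk', Submodule.mem_orthogonal_singleton_iff_inner_right,
        vsub_eq_sub, inner_sub_right, inner_sub_right, inner_smul_right, inner_smul_right, huu]
      ring
    · rw [dist_eq_norm, sub_sub_cancel, norm_smul, hu, mul_one]
      exact hy

/-- Greedy selection of separated points in a set of large measure. -/
lemma exists_separated_of_lt_measure {X : Type*} [PseudoMetricSpace X] [MeasurableSpace X]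
    (μ : Measure X) {A : Set X} {r : ℝ} {v : ENNReal}
    (hv : ∀ y ∈ A, μ (Metric.closedBall y r) ≤ v) (N : ℕ) (hN : N * v < μ A) :
    ∃ c : Fin N → X, (∀ j, c j ∈ A) ∧ ∀ i j, i ≠ j → r < dist (c i) (c j) := by
  induction N with
  | zero => exact ⟨Fin.elim0, fun j => j.elim0, fun j => j.elim0⟩
  | succ N ih =>
    have hle : (N : ENNReal) * v ≤ ((N + 1 : ℕ) : ENNReal) * v := by gcongr; simp
    obtain ⟨c, hcA, hc⟩ := ih (hle.trans_lt hN)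
    have hex : ∃ y ∈ A, ∀ i, y ∉ Metric.closedBall (c i) r := by
      by_contra! hcon
      have hsub : A ⊆ ⋃ i, Metric.closedBall (c i) r := fun y hy => Set.mem_iUnion.2 (hcon y hy)
      have : μ A ≤ N * v := by
        calc μ A ≤ μ (⋃ i, Metric.closedBall (c i) r) := measure_mono hsub
          _ ≤ ∑ i, μ (Metric.closedBall (c i) r) := measure_iUnion_fintype_le _ _
          _ ≤ ∑ _i : Fin N, v := Finset.sum_le_sum fun i _ => hv _ (hcA i)
          _ = N * v := by simp
      exact absurd (this.trans hle) (not_le.2 hN)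
    obtain ⟨y, hyA, hy⟩ := hex
    have hy' : ∀ i, r < dist y (c i) := fun i => not_le.1 (hy i)
    refine ⟨Fin.cons y c, fun j => ?_, fun i j hij => ?_⟩
    · refine Fin.cases ?_ (fun j => ?_) j
      · simpa using hyA
      · simpa using hcA j
    · induction i using Fin.cases with
      | zero =>
        induction j using Fin.cases with
        | zero => exact absurd rfl hij
        | succ j => simpa using hy' j
      | succ i =>
        induction j using Fin.cases with
        | zero => simpa [dist_comm] using hy' i
        | succ j => simpa using hc i j (fun h => hij (by rw [h]))

/-- Take `β` small and `N = ⌈β ^ (-t)⌉`. The bound with `C` makes a slab of relative width `4 * β`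
carry at most half the mass; the last bound, which holds since `β ^ (δ - t) → 0`, says that `N`
balls of relative radius `3 * β` cannot cover the other half. -/
lemma exists_branching_parameters {C γ δ c₁ c₂ t : ℝ} (hγ : 0 < γ) (hc₁ : 0 < c₁)
    (hc₂ : 0 < c₂) (ht : 0 < t) (htδ : t < δ) :
    ∃ β : ℝ, 0 < β ∧ β < 1 / 4 ∧ C * (4 * β) ^ γ ≤ 1 / 2 ∧
      ∃ N : ℕ, 1 < N ∧ β ^ (-t) ≤ N ∧ N * (c₂ * (3 * β) ^ δ) < c₁ * (1 / 2) ^ δ / 2 := by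
  have hδ : 0 < δ := ht.trans htδ
  have h1 : Filter.Tendsto (fun β : ℝ => C * (4 * β) ^ γ) (nhdsWithin 0 (Set.Ioi 0)) (nhds 0) := by
    have : ContinuousAt (fun β : ℝ => C * (4 * β) ^ γ) 0 := by
      refine continuousAt_const.mul (ContinuousAt.rpow_const (by fun_prop) (Or.inr hγ.le))
    have h := this.tendsto
    simp only [mul_zero, Real.zero_rpow hγ.ne'] at h
    exact h.mono_left nhdsWithin_le_nhds
  have h2 : Filter.Tendsto (fun β : ℝ => 2 * c₂ * 3 ^ δ * β ^ (δ - t))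
      (nhdsWithin 0 (Set.Ioi 0)) (nhds 0) := by
    have : ContinuousAt (fun β : ℝ => 2 * c₂ * 3 ^ δ * β ^ (δ - t)) 0 := by
      refine continuousAt_const.mul
        (ContinuousAt.rpow_const (by fun_prop) (Or.inr (by linarith)))
    have h := this.tendsto
    simp only [Real.zero_rpow (sub_pos.2 htδ).ne', mul_zero] at h
    exact h.mono_left nhdsWithin_le_nhds
  have hpos : 0 < c₁ * (1 / 2) ^ δ / 2 := by positivity
  obtain ⟨β, hβ1, hβ2, hβ0, hβ4⟩ := ((h1.eventually (gt_mem_nhds (show (0 : ℝ) < 1 / 2 by norm_num))).and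
    ((h2.eventually (gt_mem_nhds hpos)).and
      (Ioo_mem_nhdsGT (show (0 : ℝ) < 1 / 4 by norm_num)))).exists
  refine ⟨β, hβ0, hβ4, hβ1.le, ⌈β ^ (-t)⌉₊, ?_, Nat.le_ceil _, ?_⟩
  · rw [Nat.lt_ceil, Nat.cast_one]
    exact Real.one_lt_rpow_of_pos_of_lt_one_of_neg hβ0 (by linarith) (by linarith)
  · have hN : (⌈β ^ (-t)⌉₊ : ℝ) ≤ 2 * β ^ (-t) := by
      have h1 : 1 ≤ β ^ (-t) :=
        (Real.one_lt_rpow_of_pos_of_lt_one_of_neg hβ0 (by linarith) (by linarith)).le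
      have := (Nat.ceil_lt_add_one (a := β ^ (-t)) (by linarith)).le
      linarith
    refine lt_of_le_of_lt ?_ hβ2
    calc (⌈β ^ (-t)⌉₊ : ℝ) * (c₂ * (3 * β) ^ δ) ≤ 2 * β ^ (-t) * (c₂ * (3 * β) ^ δ) := by gcongr
      _ = 2 * c₂ * 3 ^ δ * (β ^ (-t) * β ^ δ) := by
        rw [Real.mul_rpow (by norm_num) hβ0.le]; ring
      _ = 2 * c₂ * 3 ^ δ * β ^ (δ - t) := by
        rw [← Real.rpow_add hβ0, neg_add_eq_sub]

/-- For an absolutely decaying Ahlfors regular measure of dimension `δ > t`, every small ball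
centred on the support contains at least `β ^ (-t)` well separated points of the support which
avoid a given slab of relative width `2 * β`. -/
lemma exists_separated_points_off_slab {d : ℕ} {μ : Measure (EuclideanSpace ℝ (Fin d))}
    (hdecay : IsAbsolutelyDecaying μ) {δ c₁ c₂ ρ₀ t : ℝ} (hc₁ : 0 < c₁)
    (hc₂ : 0 < c₂) (hρ₀ : 0 < ρ₀)
    (hreg : ∀ x ∈ μ.support, ∀ ρ : ℝ, 0 < ρ → ρ < ρ₀ →
      ENNReal.ofReal (c₁ * ρ ^ δ) ≤ μ (Metric.closedBall x ρ) ∧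
        μ (Metric.closedBall x ρ) ≤ ENNReal.ofReal (c₂ * ρ ^ δ)) (ht : 0 < t) (htδ : t < δ) :
    ∃ β : ℝ, 0 < β ∧ β < 1 / 4 ∧ ∃ N : ℕ, 1 < N ∧ β ^ (-t) ≤ N ∧ ∃ ρ₁ : ℝ, 0 < ρ₁ ∧
      ∀ ρ : ℝ, 0 < ρ → ρ < ρ₁ → ∀ x ∈ μ.support, ∀ (u : EuclideanSpace ℝ (Fin d)) (s : ℝ),
        ‖u‖ = 1 → ∃ c : Fin N → EuclideanSpace ℝ (Fin d),
          (∀ j, c j ∈ μ.support ∧ dist (c j) x ≤ ρ / 2 ∧ 2 * β * ρ < |⟪u, c j⟫_ℝ - s|) ∧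
          ∀ i j, i ≠ j → 3 * β * ρ < dist (c i) (c j) := by
  obtain ⟨C, γ, hC, hγ, ρ', hρ', hdec⟩ := hdecay
  obtain ⟨β, hβ0, hβ4, hβC, N, hN1, hNt, hN⟩ :=
    exists_branching_parameters (C := C) hγ hc₁ hc₂ ht htδ
  refine ⟨β, hβ0, hβ4, N, hN1, hNt, min ρ₀ ρ', lt_min hρ₀ hρ', fun ρ hρ hρ1 x hx u s hu => ?_⟩
  have hρ₀' := hρ1.trans_le (min_le_left _ _)
  have hρ'' := hρ1.trans_le (min_le_right _ _)
  -- Half the radius and twice the slab width leave room for the later displacement, at most `β *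
  -- ρ`, from a chosen point to the limit points below it.
  set B := Metric.closedBall x (ρ / 2) with hB
  set slab : Set (EuclideanSpace ℝ (Fin d)) := {y | |⟪u, y⟫_ℝ - s| ≤ 2 * β * ρ} with hslab
  set A := (μ.support ∩ B) \ slab with hA
  have hBreg := hreg x hx (ρ / 2) (by linarith) (by linarith)
  have hBtop : μ B ≠ ⊤ := (hBreg.2.trans_lt ENNReal.ofReal_lt_top).ne
  have hslabμ : μ (B ∩ slab) ≤ μ B / 2 := by
    obtain ⟨L, hL, hLs⟩ := exists_isAffineHyperplane_slab_subset hu s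
    have h := hdec (ρ / 2) (by linarith) (by linarith) x hx L hL (2 * β * ρ) (by positivity)
    have hq : 2 * β * ρ / (ρ / 2) = 4 * β := by field_simp; ring
    rw [hq] at h
    calc μ (B ∩ slab) ≤ _ := measure_mono (Set.inter_subset_inter_right _ (hLs _))
      _ ≤ _ := h.le
      _ ≤ ENNReal.ofReal (1 / 2) * μ B := by gcongr
      _ = μ B / 2 := by
        rw [ENNReal.div_eq_inv_mul, one_div, ENNReal.ofReal_inv_of_pos (by norm_num)]; simp
  have hAμ : μ B / 2 ≤ μ A := by
    have hcover : B ⊆ (B ∩ slab) ∪ A ∪ μ.supportᶜ := by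
      intro y hy
      by_cases h1 : y ∈ μ.support
      · by_cases h2 : y ∈ slab
        · exact Or.inl (Or.inl ⟨hy, h2⟩)
        · exact Or.inl (Or.inr ⟨⟨h1, hy⟩, h2⟩)
      · exact Or.inr h1
    have h1 : μ B ≤ μ B / 2 + μ A := by
      calc μ B ≤ μ ((B ∩ slab) ∪ A ∪ μ.supportᶜ) := measure_mono hcover
        _ ≤ μ (B ∩ slab) + μ A + μ μ.supportᶜ :=
          (measure_union_le _ _).trans (by gcongr; exact measure_union_le _ _)
        _ ≤ μ B / 2 + μ A := by
          rw [Measure.measure_compl_support, add_zero]; gcongr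
    nth_rewrite 1 [← ENNReal.add_halves (μ B)] at h1
    exact (ENNReal.add_le_add_iff_left (ENNReal.div_ne_top hBtop (by norm_num))).1 h1
  have hNA : N * ENNReal.ofReal (c₂ * (3 * β * ρ) ^ δ) < μ A := by
    refine lt_of_lt_of_le ?_ hAμ
    refine lt_of_lt_of_le ?_ (ENNReal.div_le_div_right hBreg.1 2)
    rw [← ENNReal.ofReal_natCast, ← ENNReal.ofReal_mul (Nat.cast_nonneg _),
      show (2 : ENNReal) = ENNReal.ofReal 2 by simp, ← ENNReal.ofReal_div_of_pos (by norm_num)]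
    rw [ENNReal.ofReal_lt_ofReal_iff (by positivity)]
    rw [Real.mul_rpow (by positivity) hρ.le, show ρ / 2 = 1 / 2 * ρ by ring,
      Real.mul_rpow (by norm_num) hρ.le]
    have := mul_lt_mul_of_pos_right hN (Real.rpow_pos_of_pos hρ δ)
    calc _ = N * (c₂ * (3 * β) ^ δ) * ρ ^ δ := by ring
      _ < _ := this
      _ = _ := by ring
  obtain ⟨c, hcA, hc⟩ := exists_separated_of_lt_measure μ (A := A) (r := 3 * β * ρ)
    (fun y hy => (hreg y hy.1.1 (3 * β * ρ) (by positivity) (by nlinarith)).2) N hNA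
  exact ⟨c, fun j => ⟨(hcA j).1.1, (hcA j).1.2, not_le.1 (hcA j).2⟩, hc⟩

/-! ### Hausdorff dimension: trees from below, mass from above. -/

/-- Lower bound for the dimension of the limit set of a tree of separated points. -/
lemma exists_limit_set_of_tree {X : Type*} [MetricSpace X] [CompleteSpace X] {K : Set X}
    (hK : IsClosed K) {N : ℕ} {β r₀ t : ℝ} (hβ0 : 0 < β) (hβ1 : β < 1 / 4) (hr₀ : 0 < r₀)
    (ht : 0 < t) (hN1 : 1 < N) (hN : β ^ (-t) ≤ N) (c : ℕ → X → Fin N → X)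
    (hc : ∀ n, ∀ x ∈ K, ∀ j, c n x j ∈ K ∧ dist (c n x j) x ≤ r₀ * β ^ n / 2)
    (hsep : ∀ n, ∀ x ∈ K, ∀ i j, i ≠ j → 3 * β * (r₀ * β ^ n) < dist (c n x i) (c n x j))
    {x₀ : X} (hx₀ : x₀ ∈ K) :
    ∃ S ⊆ K, ENNReal.ofReal t ≤ dimH S ∧ ∀ y ∈ S, ∃ x : ℕ → X, x 0 = x₀ ∧
      (∀ n, x n ∈ K ∧ dist y (x n) ≤ r₀ * β ^ n) ∧ ∀ n, ∃ j, x (n + 1) = c n (x n) j := by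
  let path : (ℕ → Fin N) → ℕ → X := fun ω n => Nat.rec x₀ (fun n x => c n x (ω n)) n
  have hsucc : ∀ ω n, path ω (n + 1) = c n (path ω n) (ω n) := fun ω n => rfl
  have hmem : ∀ ω n, path ω n ∈ K := by
    intro ω n
    induction n with
    | zero => exact hx₀
    | succ n ih => rw [hsucc]; exact (hc n _ ih _).1
  have hdist : ∀ ω n, dist (path ω n) (path ω (n + 1)) ≤ r₀ / 2 * β ^ n := by
    intro ω n
    rw [hsucc, dist_comm]
    refine ((hc n _ (hmem ω n) _).2).trans (le_of_eq (by ring))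
  have hlim : ∀ ω, ∃ y, Filter.Tendsto (path ω) Filter.atTop (nhds y) := fun ω =>
    cauchySeq_tendsto_of_complete (cauchySeq_of_le_geometric β (r₀ / 2) (by linarith) (hdist ω))
  choose lim hlim using hlim
  have hlimK : ∀ ω, lim ω ∈ K := fun ω =>
    hK.mem_of_tendsto (hlim ω) (Filter.Eventually.of_forall (hmem ω))
  have hlimd : ∀ ω n, dist (lim ω) (path ω n) ≤ r₀ * β ^ n := by
    intro ω n
    rw [dist_comm]
    refine (dist_le_of_le_geometric_of_tendsto β (r₀ / 2) (by linarith) (hdist ω) (hlim ω)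
      n).trans ?_
    rw [div_le_iff₀ (by linarith)]
    have : 0 < r₀ * β ^ n := by positivity
    nlinarith
  have hpath : ∀ (ω ω' : ℕ → Fin N) n, (∀ i < n, ω i = ω' i) → path ω n = path ω' n := by
    intro ω ω' n
    induction n with
    | zero => intro _; rfl
    | succ n ih =>
      intro h
      rw [hsucc, hsucc, ih fun i hi => h i (by omega), h n (by omega)]
  -- Siblings are more than `3 * β * ρ` apart and each limit point is within `β * ρ` of its
  -- ancestor, where `ρ = r₀ * β ^ n`.
  have hgap : ∀ (ω ω' : ℕ → Fin N) n, (∀ i < n, ω i = ω' i) → ω n ≠ ω' n →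
      β * r₀ * β ^ n < dist (lim ω) (lim ω') := by
    intro ω ω' n h hne
    have h1 := hsep n _ (hmem ω n) _ _ hne
    have h2 := hlimd ω (n + 1)
    have h3 := hlimd ω' (n + 1)
    rw [hsucc] at h2 h3
    rw [← hpath ω ω' n h] at h3
    rw [dist_comm] at h2
    have h4 := dist_triangle4 (c n (path ω n) (ω n)) (lim ω) (lim ω') (c n (path ω n) (ω' n))
    rw [pow_succ] at h2 h3
    nlinarith
  -- Reading the branch as base-`N` digits is `t`-Hölder because `N⁻¹ ≤ β ^ t`. It maps the limit
  -- set onto a set containing `[0, 1)`, so the dimension is at least `t`.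
  have hholder : ∀ ω ω', |Real.ofDigits ω - Real.ofDigits ω'| ≤
      (β * r₀)⁻¹ ^ t * dist (lim ω) (lim ω') ^ t := by
    intro ω ω'
    by_cases hne : ω = ω'
    · subst hne; simp [Real.zero_rpow ht.ne']
    · have hex : ∃ n, ω n ≠ ω' n := Function.ne_iff.1 hne
      classical
      have hagree : ∀ i < Nat.find hex, ω i = ω' i := fun i hi => not_not.1 (Nat.find_min hex hi)
      set n := Nat.find hex with hn
      have hg := hgap ω ω' n hagree (Nat.find_spec hex)
      refine (Real.abs_ofDigits_sub_ofDigits_le hagree).trans ?_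
      have hNinv : (N : ℝ)⁻¹ ≤ β ^ t := by
        rw [Real.rpow_neg hβ0.le] at hN
        exact inv_le_of_inv_le₀ (by positivity) hN
      calc ((N : ℝ) ^ n)⁻¹ = ((N : ℝ)⁻¹) ^ n := by rw [inv_pow]
        _ ≤ (β ^ t) ^ n := by gcongr
        _ = (β ^ n) ^ t := by
          rw [← Real.rpow_natCast, ← Real.rpow_natCast, ← Real.rpow_mul hβ0.le,
            ← Real.rpow_mul hβ0.le, mul_comm]
        _ ≤ ((β * r₀)⁻¹ * dist (lim ω) (lim ω')) ^ t := by
          refine Real.rpow_le_rpow (by positivity) ?_ ht.le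
          rw [le_inv_mul_iff₀ (by positivity)]
          exact hg.le
        _ = _ := Real.mul_rpow (by positivity) dist_nonneg
  have hinj : Function.Injective lim := by
    intro ω ω' h
    by_contra hne
    have hex : ∃ n, ω n ≠ ω' n := Function.ne_iff.1 hne
    classical
    have hg := hgap ω ω' _ (fun i hi => not_not.1 (Nat.find_min hex hi)) (Nat.find_spec hex)
    rw [h, dist_self] at hg
    have : 0 < β * r₀ * β ^ Nat.find hex := by positivity
    linarith
  refine ⟨Set.range lim, Set.range_subset_iff.2 hlimK, ?_, ?_⟩
  · have : NeZero N := ⟨by omega⟩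
    let h : X → ℝ := fun y => Real.ofDigits (Function.invFun lim y)
    have hh : ∀ ω, h (lim ω) = Real.ofDigits ω := fun ω => by
      simp only [h, Function.leftInverse_invFun hinj ω]
    have hhol : HolderOnWith (((β * r₀)⁻¹ ^ t).toNNReal) t.toNNReal h (Set.range lim) := by
      rintro _ ⟨ω, rfl⟩ _ ⟨ω', rfl⟩
      rw [hh, hh, edist_dist, edist_dist, Real.dist_eq, Real.coe_toNNReal _ ht.le,
        ENNReal.ofReal_rpow_of_nonneg dist_nonneg ht.le]
      change _ ≤ ENNReal.ofReal _ * _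
      rw [← ENNReal.ofReal_mul (by positivity)]
      exact ENNReal.ofReal_le_ofReal (hholder ω ω')
    have hdim := hhol.dimH_image_le (Real.toNNReal_pos.2 ht)
    have hsub : Set.Ico (0 : ℝ) 1 ⊆ h '' Set.range lim := by
      intro x hx
      exact ⟨lim (Real.digits x N), ⟨_, rfl⟩, by rw [hh, Real.ofDigits_digits hN1 hx]⟩
    have hone : dimH (Set.Ico (0 : ℝ) 1) = 1 := by
      rw [Real.dimH_of_nonempty_interior]
      · simp
      · rw [interior_Ico]; exact Set.nonempty_Ioo.2 one_pos
    have h1 : (1 : ENNReal) ≤ dimH (Set.range lim) / (t.toNNReal : ENNReal) := by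
      rw [← hone]; exact (dimH_mono hsub).trans hdim
    rw [ENNReal.le_div_iff_mul_le (Or.inl (by simpa using ht)) (Or.inl (by simp)), one_mul] at h1
    exact h1
  · rintro _ ⟨ω, rfl⟩
    exact ⟨path ω, rfl, fun n => ⟨hmem ω n, hlimd ω n⟩, fun n => ⟨ω n, rfl⟩⟩

/-- A bounded set all of whose points have balls of measure at least `c₁ * ρ ^ δ` has dimension
at most `δ`. -/
lemma dimH_le_of_le_measure_closedBall {X : Type*} [MetricSpace X] [MeasurableSpace X]
    [BorelSpace X] (μ : Measure X) {s T : Set X} {δ c₁ ρ₀ : ℝ} (hδ : 0 < δ) (hc₁ : 0 < c₁)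
    (hρ₀ : 0 < ρ₀) (hT : μ T ≠ ⊤) (hsT : ∀ x ∈ s, Metric.closedBall x ρ₀ ⊆ T)
    (hlow : ∀ x ∈ s, ∀ ρ : ℝ, 0 < ρ → ρ < ρ₀ →
      ENNReal.ofReal (c₁ * ρ ^ δ) ≤ μ (Metric.closedBall x ρ)) :
    dimH s ≤ ENNReal.ofReal δ := by
  have hcard : ∀ ρ : ℝ, 0 < ρ → ρ < ρ₀ → ∀ F : Finset X, (F : Set X) ⊆ s →
      (F : Set X).Pairwise (fun x y => 2 * ρ < dist x y) →
      F.card * ENNReal.ofReal (c₁ * ρ ^ δ) ≤ μ T := by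
    intro ρ hρ hρ1 F hFs hF
    calc F.card * ENNReal.ofReal (c₁ * ρ ^ δ) = ∑ _x ∈ F, ENNReal.ofReal (c₁ * ρ ^ δ) := by simp
      _ ≤ ∑ x ∈ F, μ (Metric.closedBall x ρ) :=
        Finset.sum_le_sum fun x hx => hlow x (hFs hx) ρ hρ hρ1
      _ = μ (⋃ x ∈ F, Metric.closedBall x ρ) := by
        refine (measure_biUnion_finset (fun x hx y hy hxy => ?_)
          (fun x _ => Metric.isClosed_closedBall.measurableSet)).symm
        exact Metric.closedBall_disjoint_closedBall (by linarith [hF hx hy hxy])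
      _ ≤ μ T := measure_mono (Set.iUnion₂_subset fun x hx =>
        (Metric.closedBall_subset_closedBall hρ1.le).trans (hsT x (hFs hx)))
  -- If no such net existed, separated sets could be enlarged forever, against the packing bound
  -- `hcard`.
  have hnet : ∀ ρ : ℝ, 0 < ρ → ρ < ρ₀ → ∃ F : Finset X,
      s ⊆ ⋃ x : F, Metric.closedBall (x : X) (2 * ρ) ∧
      F.card * ENNReal.ofReal (c₁ * ρ ^ δ) ≤ μ T := by
    intro ρ hρ hρ1
    by_contra! hcon
    have hall : ∀ k : ℕ, ∃ F : Finset X, F.card = k ∧ (F : Set X) ⊆ s ∧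
        (F : Set X).Pairwise (fun x y => 2 * ρ < dist x y) := by
      intro k
      induction k with
      | zero => exact ⟨∅, by simp⟩
      | succ k ih =>
        obtain ⟨F, hFk, hFs, hF⟩ := ih
        have hnc : ¬ s ⊆ ⋃ x : F, Metric.closedBall (x : X) (2 * ρ) := fun h =>
          absurd (hcard ρ hρ hρ1 F hFs hF) (not_le.2 (hcon F h))
        obtain ⟨y, hys, hy⟩ := Set.not_subset.1 hnc
        have hy' : ∀ x ∈ F, 2 * ρ < dist y x := fun x hx => by
          by_contra! hle
          exact hy (Set.mem_iUnion.2 ⟨⟨x, hx⟩, hle⟩)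
        have hyF : y ∉ F := fun h => by
          have := hy' y h
          rw [dist_self] at this
          linarith
        classical
        refine ⟨insert y F, by rw [Finset.card_insert_of_notMem hyF, hFk], ?_, ?_⟩
        · rw [Finset.coe_insert]; exact Set.insert_subset hys hFs
        · rw [Finset.coe_insert]
          refine hF.insert fun x hx _ => ⟨hy' x hx, ?_⟩
          rw [dist_comm]; exact hy' x hx
    have hv : ENNReal.ofReal (c₁ * ρ ^ δ) ≠ 0 := by
      simpa using (by positivity : 0 < c₁ * ρ ^ δ)
    obtain ⟨k, hk⟩ := ENNReal.exists_nat_mul_gt hv hT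
    obtain ⟨F, hFk, hFs, hF⟩ := hall k
    have := hcard ρ hρ hρ1 F hFs hF
    rw [hFk] at this
    exact absurd this (not_le.2 hk)
  -- The shift by 2 keeps the scale strictly below `ρ₀` already at `n = 0`.
  have hρn : ∀ n : ℕ, 0 < ρ₀ / (n + 2) ∧ ρ₀ / (n + 2) < ρ₀ := fun n =>
    ⟨by positivity, div_lt_self hρ₀ (by have := Nat.cast_nonneg (α := ℝ) n; linarith)⟩
  choose F hFs hFc using fun n : ℕ => hnet (ρ₀ / (n + 2)) (hρn n).1 (hρn n).2
  have hdiam : ∀ (x : X) (n : ℕ), Metric.ediam (Metric.closedBall x (2 * (ρ₀ / (n + 2)))) ≤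
      ENNReal.ofReal (4 * (ρ₀ / (n + 2))) := by
    intro x n
    refine Metric.ediam_le fun y hy z hz => ?_
    rw [edist_dist]
    refine ENNReal.ofReal_le_ofReal ?_
    have h1 := dist_triangle_right y z x
    have h2 := Metric.mem_closedBall.1 hy
    have h3 := Metric.mem_closedBall.1 hz
    linarith
  have hmeas : μH[δ] s ≤ μ T * ENNReal.ofReal (4 ^ δ / c₁) := by
    refine (Measure.hausdorffMeasure_le_liminf_sum (l := Filter.atTop) δ s
      (fun n : ℕ => ENNReal.ofReal (4 * (ρ₀ / (n + 2)))) ?_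
      (fun n (x : F n) => Metric.closedBall (x : X) (2 * (ρ₀ / (n + 2))))
      (Filter.Eventually.of_forall fun n x => hdiam _ n)
      (Filter.Eventually.of_forall hFs)).trans ?_
    · rw [← ENNReal.ofReal_zero]
      refine ENNReal.tendsto_ofReal ?_
      have h1 : Filter.Tendsto (fun n : ℕ => (n : ℝ) + 2) Filter.atTop Filter.atTop :=
        Filter.tendsto_atTop_add_const_right _ _ tendsto_natCast_atTop_atTop
      simpa using (h1.const_div_atTop ρ₀).const_mul 4
    · refine Filter.liminf_le_of_le (by isBoundedDefault) fun b hb => ?_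
      obtain ⟨n, hn⟩ := hb.exists
      refine hn.trans ?_
      obtain ⟨hρ, -⟩ := hρn n
      set ρ := ρ₀ / ((n : ℝ) + 2) with hρdef
      calc ∑ x : F n, Metric.ediam (Metric.closedBall (x : X) (2 * ρ)) ^ δ
          ≤ ∑ _x : F n, ENNReal.ofReal (4 * ρ) ^ δ :=
            Finset.sum_le_sum fun x _ => ENNReal.rpow_le_rpow (hdiam _ n) hδ.le
        _ = (F n).card * ENNReal.ofReal (c₁ * ρ ^ δ) * ENNReal.ofReal (4 ^ δ / c₁) := by
          rw [Finset.sum_const, Finset.card_univ, Fintype.card_coe, nsmul_eq_mul, mul_assoc,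
            ← ENNReal.ofReal_mul (by positivity),
            ENNReal.ofReal_rpow_of_nonneg (by positivity) hδ.le,
            Real.mul_rpow (by norm_num) hρ.le]
          congr 2
          field_simp
        _ ≤ _ := by gcongr; exact hFc n
  have hfin : μH[((δ.toNNReal : NNReal) : ℝ)] s ≠ ⊤ := by
    rw [Real.coe_toNNReal _ hδ.le]
    exact (hmeas.trans_lt (ENNReal.mul_lt_top hT.lt_top ENNReal.ofReal_lt_top)).ne
  exact dimH_le_of_hausdorffMeasure_ne_top hfin

/-! ### Scheduling the maps and assembling the proof. -/

lemma padicValNat_two_pow_mul_odd (i k : ℕ) : padicValNat 2 (2 ^ i * (2 * k + 1)) = i := by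
  rw [padicValNat.mul (by positivity) (by omega), padicValNat.prime_pow,
    padicValNat.eq_zero_of_not_dvd (by omega), add_zero]

lemma dimH_support_le {d : ℕ} {μ : Measure (EuclideanSpace ℝ (Fin d))} [IsLocallyFiniteMeasure μ]
    {δ c₁ ρ₀ : ℝ} (hδ : 0 < δ) (hc₁ : 0 < c₁) (hρ₀ : 0 < ρ₀)
    (hlow : ∀ x ∈ μ.support, ∀ ρ : ℝ, 0 < ρ → ρ < ρ₀ →
      ENNReal.ofReal (c₁ * ρ ^ δ) ≤ μ (Metric.closedBall x ρ)) :
    dimH μ.support ≤ ENNReal.ofReal δ := by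
  have hcov : μ.support ⊆ ⋃ n : ℕ, μ.support ∩ Metric.closedBall 0 (n : ℝ) := by
    rw [← Set.inter_iUnion, Metric.iUnion_closedBall_nat, Set.inter_univ]
  refine (dimH_mono hcov).trans ?_
  rw [dimH_iUnion]
  refine iSup_le fun n => ?_
  refine dimH_le_of_le_measure_closedBall μ (T := Metric.closedBall 0 (ρ₀ + n)) hδ hc₁ hρ₀
    (isCompact_closedBall _ _).measure_lt_top.ne (fun x hx => ?_) fun x hx => hlow x hx.1
  exact Metric.closedBall_subset_closedBall' (by linarith [Metric.mem_closedBall.1 hx.2])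

/-- The support of an absolutely decaying Ahlfors regular measure of dimension `δ > t` contains,
near each of its points in `U`, a set of dimension at least `t` which all the given diffeomorphisms
map to badly approximable vectors. -/
lemma le_dimH_iInter_preimage_BA {d : ℕ} (hd : 0 < d) {μ : Measure (EuclideanSpace ℝ (Fin d))}
    (hdecay : IsAbsolutelyDecaying μ) {δ c₁ c₂ ρ₀ t : ℝ} (hc₁ : 0 < c₁) (hc₂ : 0 < c₂)
    (hρ₀ : 0 < ρ₀)
    (hreg : ∀ x ∈ μ.support, ∀ ρ : ℝ, 0 < ρ → ρ < ρ₀ →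
      ENNReal.ofReal (c₁ * ρ ^ δ) ≤ μ (Metric.closedBall x ρ) ∧
        μ (Metric.closedBall x ρ) ≤ ENNReal.ofReal (c₂ * ρ ^ δ)) (ht : 0 < t) (htδ : t < δ)
    {U : Set (EuclideanSpace ℝ (Fin d))} (hU : IsOpen U) (hUK : (U ∩ μ.support).Nonempty)
    {f : ℕ → EuclideanSpace ℝ (Fin d) → EuclideanSpace ℝ (Fin d)}
    (hf : ∀ i, IsC1DiffeoOn (f i) U) :
    ENNReal.ofReal t ≤ dimH ((⋂ i, (U ∩ f i ⁻¹' BA d)) ∩ μ.support) := by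
  obtain ⟨x₀, hx₀U, hx₀⟩ := hUK
  obtain ⟨β, hβ0, hβ4, N, hN1, hNt, ρ₁, hρ₁, hpts⟩ :=
    exists_separated_points_off_slab hdecay hc₁ hc₂ hρ₀ hreg ht htδ
  obtain ⟨R, hR, hB⟩ := Metric.nhds_basis_closedBall.mem_iff.1 (hU.mem_nhds hx₀U)
  obtain ⟨r, hr, hrR, hrρ⟩ : ∃ r, 0 < r ∧ 2 * r ≤ R ∧ r < ρ₁ := by
    refine ⟨min (R / 2) (ρ₁ / 2), by positivity, ?_, ?_⟩
    · linarith [min_le_left (R / 2) (ρ₁ / 2)]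
    · linarith [min_le_right (R / 2) (ρ₁ / 2)]
  have hscale : ∀ n : ℕ, 0 < r * β ^ n := fun n => by positivity
  have hscale_le : ∀ n : ℕ, r * β ^ n ≤ r := fun n =>
    mul_le_of_le_one_right hr.le (pow_le_one₀ hβ0.le (by linarith))
  choose a b σ ha hb hσ hslab using fun i => (hf i).exists_slab hd hU hB hβ0
  -- Outside the ball, or at scales too coarse for the map in charge, an arbitrary slab is used, so
  -- that the choice is total.
  have hus : ∀ (n : ℕ) (x : EuclideanSpace ℝ (Fin d)), ∃ (u : EuclideanSpace ℝ (Fin d)) (s : ℝ),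
      ‖u‖ = 1 ∧ (x ∈ Metric.closedBall x₀ R → r * β ^ n ≤ σ (padicValNat 2 (n + 1)) →
        ∀ y ∈ Metric.closedBall x₀ R, ‖y - x‖ ≤ r * β ^ n →
          β * (r * β ^ n) < |⟪u, y⟫_ℝ - s| → ∀ (p : Fin d → ℤ) (q : ℕ), 0 < q →
            (q : ℝ) ^ (1 + 1 / (d : ℝ)) * (r * β ^ n) < a (padicValNat 2 (n + 1)) →
            b (padicValNat 2 (n + 1)) * (r * β ^ n) ≤
              ‖f (padicValNat 2 (n + 1)) y - ratVec p q‖) := by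
    intro n x
    by_cases h : x ∈ Metric.closedBall x₀ R ∧ r * β ^ n ≤ σ (padicValNat 2 (n + 1))
    · obtain ⟨u, s, hu, H⟩ := hslab _ _ (hscale n) h.2 x h.1
      exact ⟨u, s, hu, fun _ _ => H⟩
    · exact ⟨EuclideanSpace.single ⟨0, hd⟩ 1, 0, by simp, fun h1 h2 => absurd ⟨h1, h2⟩ h⟩
  choose u s hu hus using hus
  have hchild : ∀ (n : ℕ) (x : EuclideanSpace ℝ (Fin d)),
      ∃ c : Fin N → EuclideanSpace ℝ (Fin d), x ∈ μ.support →
        (∀ j, c j ∈ μ.support ∧ dist (c j) x ≤ r * β ^ n / 2 ∧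
          2 * β * (r * β ^ n) < |⟪u n x, c j⟫_ℝ - s n x|) ∧
        ∀ i j, i ≠ j → 3 * β * (r * β ^ n) < dist (c i) (c j) := by
    intro n x
    by_cases hx : x ∈ μ.support
    · obtain ⟨c, hc⟩ := hpts _ (hscale n) ((hscale_le n).trans_lt hrρ) x hx (u n x) (s n x)
        (hu n x)
      exact ⟨c, fun _ => hc⟩
    · exact ⟨fun _ => x, fun h => absurd h hx⟩
  choose c hc using hchild
  obtain ⟨S, hSK, hSdim, hS⟩ := exists_limit_set_of_tree Measure.isClosed_support hβ0 hβ4 hr ht hN1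
    hNt c (fun n x hx j => ⟨((hc n x hx).1 j).1, ((hc n x hx).1 j).2.1⟩)
    (fun n x hx => (hc n x hx).2) hx₀
  refine hSdim.trans (dimH_mono fun y hy => ⟨Set.mem_iInter.2 fun i => ?_, hSK hy⟩)
  obtain ⟨x, hx0, hx, hxc⟩ := hS y hy
  have hy0 : dist y x₀ ≤ r := by simpa [hx0] using (hx 0).2
  have hyB : y ∈ Metric.closedBall x₀ R := Metric.mem_closedBall.2 (by linarith)
  have hxB : ∀ n, x n ∈ Metric.closedBall x₀ R := fun n => by
    have h1 := dist_triangle_left (x n) x₀ y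
    have h2 := (hx n).2.trans (hscale_le n)
    exact Metric.mem_closedBall.2 (by linarith)
  -- The child is off the slab of half-width `2 * β * ρ` and `y` lies within `β * ρ` of it, where `ρ
  -- = r * β ^ n`.
  have hoff : ∀ n, β * (r * β ^ n) < |⟪u n (x n), y⟫_ℝ - s n (x n)| := by
    intro n
    obtain ⟨j, hj⟩ := hxc n
    have h1 := ((hc n (x n) (hx n).1).1 j).2.2
    rw [← hj] at h1
    have h2 : |⟪u n (x n), x (n + 1)⟫_ℝ - ⟪u n (x n), y⟫_ℝ| ≤ β * (r * β ^ n) := by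
      rw [← inner_sub_right]
      refine (abs_real_inner_le_norm _ _).trans ?_
      rw [hu, one_mul, ← dist_eq_norm, dist_comm]
      exact (hx (n + 1)).2.trans (le_of_eq (by ring))
    have h3 := abs_sub_le ⟪u n (x n), x (n + 1)⟫_ℝ ⟪u n (x n), y⟫_ℝ (s n (x n))
    linarith
  refine ⟨hB hyB, ?_⟩
  -- From level `J` on, the scale is below `σ i`; the levels `n ≥ J` used have `n + 1 = 2 ^ i * (2 *
  -- (J + k) + 1)`, with gap `2 ^ (i + 1)`.
  obtain ⟨J, hJ⟩ := exists_pow_lt_of_lt_one (div_pos (hσ i) hr) (show β < 1 by linarith)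
  rw [lt_div_iff₀ hr] at hJ
  have hpow : 0 < 2 ^ i := by positivity
  have hn₀ : ∀ k, 2 ^ i * (2 * J + 1) - 1 + 2 ^ (i + 1) * k + 1 = 2 ^ i * (2 * (J + k) + 1) := by
    intro k
    have h1 : 0 < 2 ^ i * (2 * J + 1) := by positivity
    have h2 : 2 ^ i * (2 * (J + k) + 1) = 2 ^ i * (2 * J + 1) + 2 ^ (i + 1) * k := by ring
    omega
  have hn₀J : J ≤ 2 ^ i * (2 * J + 1) - 1 := by
    have : 1 * (2 * J + 1) ≤ 2 ^ i * (2 * J + 1) := Nat.mul_le_mul_right _ hpow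
    omega
  set n₀ := 2 ^ i * (2 * J + 1) - 1 with hn₀def
  refine mem_BA_of_geometric_scales (ha i) (hb i) (hscale n₀)
    (show 0 < β ^ 2 ^ (i + 1) by positivity)
    (pow_lt_one₀ hβ0.le (by linarith) (by positivity)) fun k p q hq hqa => ?_
  have hsc : r * β ^ n₀ * (β ^ 2 ^ (i + 1)) ^ k = r * β ^ (n₀ + 2 ^ (i + 1) * k) := by
    rw [pow_add β, pow_mul β, mul_assoc]
  rw [hsc] at hqa ⊢
  set n := n₀ + 2 ^ (i + 1) * k with hn
  have hi : padicValNat 2 (n + 1) = i := by rw [hn, hn₀ k, padicValNat_two_pow_mul_odd]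
  have hle : r * β ^ n ≤ σ i := by
    have : β ^ n ≤ β ^ J := pow_le_pow_of_le_one hβ0.le (by linarith) (by omega)
    nlinarith
  have key := hus n (x n) (hxB n)
  rw [hi] at key
  exact key hle y hyB (by rw [← dist_eq_norm]; exact (hx n).2) (hoff n) p q hq hqa

theorem theorem1p1 (d : ℕ) (μ : Measure (EuclideanSpace ℝ (Fin d))) [IsLocallyFiniteMeasure μ]
    (hdecay : IsAbsolutelyDecaying μ) (hreg : IsAhlforsRegular μ) :
    IsStronglyC1IncompressibleOn (BA d) μ.support := by
  intro U hU hUK f hf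
  rcases Nat.eq_zero_or_pos d with rfl | hd
  · rw [dimH_subsingleton (Set.subsingleton_of_subsingleton),
      dimH_subsingleton (Set.subsingleton_of_subsingleton)]
  refine le_antisymm
    (dimH_mono (Set.inter_subset_inter_left _ fun x hx => (Set.mem_iInter.1 hx 0).1)) ?_
  obtain ⟨δ, c₁, c₂, ρ₀, hδ, hc₁, hc₂, hρ₀, hreg⟩ := hreg
  refine ((dimH_mono Set.inter_subset_right).trans
    (dimH_support_le hδ hc₁ hρ₀ fun x hx ρ h1 h2 => (hreg x hx ρ h1 h2).1)).trans ?_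
  refine le_of_forall_lt_imp_le_of_dense fun a ha => ?_
  have haδ : a.toReal < δ := ENNReal.toReal_lt_of_lt_ofReal ha
  calc a = ENNReal.ofReal a.toReal := (ENNReal.ofReal_toReal ha.ne_top).symm
    -- The maximum with `δ / 2` keeps the exponent positive.
    _ ≤ ENNReal.ofReal (max a.toReal (δ / 2)) := ENNReal.ofReal_le_ofReal (le_max_left _ _)
    _ ≤ _ := le_dimH_iInter_preimage_BA hd hdecay hc₁ hc₂ hρ₀ hreg
      (lt_max_of_lt_right (by linarith)) (max_lt haδ (by linarith)) hU hUK hf
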